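/- An affine plane is a set of points with a family of subsets, called lines, such that any two distinct points lie on exactly one line, through any point $P$ not on a line $\ell$ there is exactly one line disjoint from $\ell$, and there are three non-collinear points. Two lines are parallel if they are equal or disjoint. The plane is a Desargues affine plane if Desargues' axiom holds in it, for three distinct parallel lines as well as for three distinct lines with a common point. For points $O\neq I$ of a Desargues affine plane let $\ell^{OI}$ be the line through them, with the addition and multiplication of points with zero $O$ and unit $I$: for $A,B\in\ell^{OI}$ and any auxiliary point $B_1\notin\ell^{OI}$, * $A+B$ is the intersection of $\ell^{OI}$ with the parallel to $BB_1$ through $P_1$, where $P_1$ is the intersection of the parallel to $OI$ through $B_1$ and the parallel to $OB_1$ through $A$; * $A\cdot B$ is the intersection of $\ell^{OI}$ with the parallel to $BB_1$ through $P_1$, where $P_1$ is the intersection of the parallel to $IB_1$ through $A$ and the line $OB_1$. With these operations $\ell^{OI}$ is a skew field. For $A,B,C\in\ell^{OI}$ with $B\neq C$ the ratio is the point $r(A,B;C)=(B-C)^{-1}(A-C)$ of $\ell^{OI}$. A dilatation is a bijection $\delta$ of the set of points that maps lines to lines and satisfies $\delta(PQ)\parallel PQ$ for all points $P\neq Q$.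 **Theorem.** Let $\delta$ be a dilatation of a Desargues affine plane, let $O\neq I$ be points, and let $A,B,C\in\ell^{OI}$ with $B\neq C$. Then $$\delta\bigl(r(A,B;C)\bigr)=r\bigl(\delta(A),\delta(B);\delta(C)\bigr),$$ where the ratio on the left is taken in the skew field $\ell^{OI}$ with zero $O$ and unit $I$, and the ratio on the right is taken in the skew field of the image line $\delta(\ell^{OI})=\ell^{O'I'}$ with zero $O'=\delta(O)$ and unit $I'=\delta(I)$. This holds for every dilatation: with a fixed point on $\ell^{OI}$, with a fixed point off $\ell^{OI}$, or with no fixed point. -/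

import Mathlib

/-- An affine plane on the set of points `P`: a family of subsets of `P` (the lines) such that two
distinct points lie on exactly one line, the Playfair parallel axiom holds, and there are three
non-collinear points. -/
structure AffinePlane (P : Type*) where
  lines : Set (Set P)
  existsUnique_line : ∀ A B : P, A ≠ B → ∃! ℓ : Set P, ℓ ∈ lines ∧ A ∈ ℓ ∧ B ∈ ℓ
  playfair : ∀ (A : P) (ℓ : Set P), ℓ ∈ lines → A ∉ ℓ →
    ∃! m : Set P, m ∈ lines ∧ A ∈ m ∧ ℓ ∩ m = ∅
  exists_noncollinear : ∃ A B C : P, A ≠ B ∧ B ≠ C ∧ A ≠ C ∧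
    ¬ ∃ ℓ ∈ lines, A ∈ ℓ ∧ B ∈ ℓ ∧ C ∈ ℓ

namespace AffinePlane

/-- Parallelism of lines: equal or disjoint. -/
def Parallel {P : Type*} (ℓ m : Set P) : Prop := ℓ = m ∨ ℓ ∩ m = ∅

/-- Desargues' axiom, in its two affine forms (parallel lines, and lines through one point): if
`A, A'`, `B, B'`, `C, C'` are pairs of distinct points on three distinct lines which are parallel or
have a common point, and `AB ∥ A'B'`, `BC ∥ B'C'`, then `AC ∥ A'C'`. The lines `AB`, `A'B'`, ... are
written `c`, `c'`, ... -/
def Desargues {P : Type*} (π : AffinePlane P) : Prop :=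
  ∀ (A B C A' B' C' : P), A ≠ A' → B ≠ B' → C ≠ C' →
  ∀ ℓ₁ ∈ π.lines, ∀ ℓ₂ ∈ π.lines, ∀ ℓ₃ ∈ π.lines, ℓ₁ ≠ ℓ₂ → ℓ₂ ≠ ℓ₃ → ℓ₁ ≠ ℓ₃ →
  A ∈ ℓ₁ → A' ∈ ℓ₁ → B ∈ ℓ₂ → B' ∈ ℓ₂ → C ∈ ℓ₃ → C' ∈ ℓ₃ →
  ((Parallel ℓ₁ ℓ₂ ∧ Parallel ℓ₂ ℓ₃) ∨ ∃ V : P, V ∈ ℓ₁ ∧ V ∈ ℓ₂ ∧ V ∈ ℓ₃) →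
  A ≠ B → B ≠ C → A ≠ C → A' ≠ B' → B' ≠ C' → A' ≠ C' →
  ∀ c ∈ π.lines, ∀ c' ∈ π.lines, ∀ a ∈ π.lines, ∀ a' ∈ π.lines, ∀ b ∈ π.lines, ∀ b' ∈ π.lines,
  A ∈ c → B ∈ c → A' ∈ c' → B' ∈ c' →
  B ∈ a → C ∈ a → B' ∈ a' → C' ∈ a' →
  A ∈ b → C ∈ b → A' ∈ b' → C' ∈ b' →
  Parallel c c' → Parallel a a' → Parallel b b'

/-- The line through two distinct points `A` and `B` (the only line that contains both). -/
def line {P : Type*} (π : AffinePlane P) (A B : P) : Set P :=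
  ⋂₀ {ℓ | ℓ ∈ π.lines ∧ A ∈ ℓ ∧ B ∈ ℓ}

/-- The parallel to the line `ℓ` through the point `X` (the only line through `X` parallel
to `ℓ`). -/
def par {P : Type*} (π : AffinePlane P) (ℓ : Set P) (X : P) : Set P :=
  ⋂₀ {m | m ∈ π.lines ∧ X ∈ m ∧ Parallel m ℓ}

section Basic

variable {P : Type*} (π : AffinePlane P)

theorem line_eq {A B : P} (h : A ≠ B) {ℓ : Set P} (hℓ : ℓ ∈ π.lines) (hA : A ∈ ℓ) (hB : B ∈ ℓ) :
    π.line A B = ℓ := by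
  have : {m | m ∈ π.lines ∧ A ∈ m ∧ B ∈ m} = {ℓ} := by
    ext m
    constructor
    · intro hm
      exact (π.existsUnique_line A B h).unique hm ⟨hℓ, hA, hB⟩
    · rintro rfl
      exact ⟨hℓ, hA, hB⟩
  rw [line, this, Set.sInter_singleton]

theorem line_spec {A B : P} (h : A ≠ B) :
    π.line A B ∈ π.lines ∧ A ∈ π.line A B ∧ B ∈ π.line A B := by
  obtain ⟨ℓ, ⟨h1, h2, h3⟩, -⟩ := π.existsUnique_line A B h
  rw [π.line_eq h h1 h2 h3]
  exact ⟨h1, h2, h3⟩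

theorem left_mem_line (A B : P) : A ∈ π.line A B := fun _ h => h.2.1

theorem right_mem_line (A B : P) : B ∈ π.line A B := fun _ h => h.2.2

theorem Parallel.symm {ℓ m : Set P} (h : Parallel ℓ m) : Parallel m ℓ := by
  rcases h with h | h
  · exact Or.inl h.symm
  · exact Or.inr (by rw [Set.inter_comm]; exact h)

theorem Parallel.eq_of_mem {ℓ m : Set P} (h : Parallel ℓ m) {X : P} (h1 : X ∈ ℓ) (h2 : X ∈ m) :
    ℓ = m := by
  rcases h with h | h
  · exact h
  · exact absurd (h ▸ (⟨h1, h2⟩ : X ∈ ℓ ∩ m)) (Set.notMem_empty X)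

theorem exists_of_not_parallel {ℓ m : Set P} (h : ¬ Parallel ℓ m) : ∃ X, X ∈ ℓ ∧ X ∈ m := by
  by_contra hc
  exact h (Or.inr (Set.eq_empty_of_forall_notMem fun X hX => hc ⟨X, hX⟩))

theorem eq_of_parallel {ℓ m m' : Set P} (hℓ : ℓ ∈ π.lines) (hm : m ∈ π.lines)
    (hm' : m' ∈ π.lines) {X : P} (hX : X ∈ m) (hX' : X ∈ m') (h : Parallel m ℓ)
    (h' : Parallel m' ℓ) : m = m' := by
  by_cases hc : X ∈ ℓ
  · rw [h.eq_of_mem hX hc, h'.eq_of_mem hX' hc]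
  · have aux : ∀ k : Set P, X ∈ k → Parallel k ℓ → ℓ ∩ k = ∅ := by
      rintro k hk (rfl | h0)
      · exact absurd hk hc
      · rw [Set.inter_comm]; exact h0
    exact (π.playfair X ℓ hℓ hc).unique ⟨hm, hX, aux m hX h⟩ ⟨hm', hX', aux m' hX' h'⟩

theorem parallel_trans {ℓ m k : Set P} (hℓ : ℓ ∈ π.lines) (hm : m ∈ π.lines) (hk : k ∈ π.lines)
    (h1 : Parallel ℓ m) (h2 : Parallel m k) : Parallel ℓ k := by
  by_contra hc
  obtain ⟨X, hX, hX'⟩ := exists_of_not_parallel hc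
  exact hc (Or.inl (π.eq_of_parallel hm hℓ hk hX hX' h1 h2.symm))

theorem par_eq {ℓ m : Set P} (hℓ : ℓ ∈ π.lines) (hm : m ∈ π.lines) {X : P} (hX : X ∈ m)
    (h : Parallel m ℓ) : π.par ℓ X = m := by
  have : {k | k ∈ π.lines ∧ X ∈ k ∧ Parallel k ℓ} = {m} := by
    ext k
    constructor
    · intro hk
      exact π.eq_of_parallel hℓ hk.1 hm hk.2.1 hX hk.2.2 h
    · rintro rfl
      exact ⟨hm, hX, h⟩
  rw [par, this, Set.sInter_singleton]

theorem par_spec {ℓ : Set P} (hℓ : ℓ ∈ π.lines) (X : P) :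
    π.par ℓ X ∈ π.lines ∧ X ∈ π.par ℓ X ∧ Parallel (π.par ℓ X) ℓ := by
  by_cases hc : X ∈ ℓ
  · rw [π.par_eq hℓ hℓ hc (Or.inl rfl)]
    exact ⟨hℓ, hc, Or.inl rfl⟩
  · obtain ⟨m, ⟨h1, h2, h3⟩, -⟩ := π.playfair X ℓ hℓ hc
    have h4 : Parallel m ℓ := Parallel.symm (Or.inr h3)
    rw [π.par_eq hℓ h1 h2 h4]
    exact ⟨h1, h2, h4⟩

theorem exists_mem_par {ℓ m k : Set P} (hℓ : ℓ ∈ π.lines) (hm : m ∈ π.lines) (hk : k ∈ π.lines)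
    (hkℓ : Parallel k ℓ) (h : ¬ Parallel m ℓ) (X : P) : ∃ Y, Y ∈ π.par m X ∧ Y ∈ k := by
  apply exists_of_not_parallel
  intro hc
  obtain ⟨h1, -, h3⟩ := π.par_spec hm X
  exact h (π.parallel_trans hm h1 hℓ h3.symm (π.parallel_trans h1 hk hℓ hc hkℓ))

theorem not_parallel_line {ℓ : Set P} {X Y : P} (hX : X ∈ ℓ) (hY : Y ∉ ℓ) :
    ¬ Parallel (π.line X Y) ℓ := fun h =>
  hY (h.eq_of_mem (π.left_mem_line X Y) hX ▸ π.right_mem_line X Y)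

theorem exists_notMem {ℓ : Set P} (hℓ : ℓ ∈ π.lines) : ∃ X, X ∉ ℓ := by
  by_contra! hc
  obtain ⟨A, B, C, -, -, -, h⟩ := π.exists_noncollinear
  exact h ⟨ℓ, hℓ, hc A, hc B, hc C⟩

end Basic

/-- A line `ℓ^{OI}` together with its zero point `O` and its unit point `I ≠ O`. -/
structure Frame (P : Type*) where
  O : P
  I : P
  ne : O ≠ I

/-- The points of the line `ℓ^{OI}`. -/
def Pt {P : Type*} (π : AffinePlane P) (F : Frame P) : Type _ := {X : P // X ∈ π.line F.O F.I}

section Skewfield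

variable {P : Type*} {π : AffinePlane P} {F : Frame P}

/-- The zero `O` of `ℓ^{OI}`. -/
def zero (π : AffinePlane P) (F : Frame P) : π.Pt F := ⟨F.O, π.left_mem_line F.O F.I⟩

/-- The unit `I` of `ℓ^{OI}`. -/
def one (π : AffinePlane P) (F : Frame P) : π.Pt F := ⟨F.I, π.right_mem_line F.O F.I⟩

/-- `C` is obtained from `A` and `B` by the addition construction on `ℓ^{OI}` with auxiliary
point `B₁`: `P₁` is the intersection of the parallel to `OI` through `B₁` and the parallel to `OB₁`
through `A`, and `C` is the intersection of `OI` and the parallel to `BB₁` through `P₁`. -/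
def IsSum (A B C : π.Pt F) : Prop :=
  ∃ B₁ : P, B₁ ∉ π.line F.O F.I ∧
    ∃ P₁ : P, P₁ ∈ π.par (π.line F.O F.I) B₁ ∧ P₁ ∈ π.par (π.line F.O B₁) A.1 ∧
      C.1 ∈ π.par (π.line B.1 B₁) P₁

/-- `C` is obtained from `A` and `B` by the multiplication construction on `ℓ^{OI}` with auxiliary
point `B₁`: `P₁` is the intersection of the parallel to `IB₁` through `A` and the line `OB₁`, and `C`
is the intersection of `OI` and the parallel to `BB₁` through `P₁`. -/
def IsProd (A B C : π.Pt F) : Prop :=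
  ∃ B₁ : P, B₁ ∉ π.line F.O F.I ∧
    ∃ P₁ : P, P₁ ∈ π.par (π.line F.I B₁) A.1 ∧ P₁ ∈ π.line F.O B₁ ∧
      C.1 ∈ π.par (π.line B.1 B₁) P₁

theorem exists_sum_aux (A : π.Pt F) {B₁ : P} (hB₁ : B₁ ∉ π.line F.O F.I) :
    ∃ P₁ : P, P₁ ∈ π.par (π.line F.O F.I) B₁ ∧ P₁ ∈ π.par (π.line F.O B₁) A.1 := by
  have hℓ := (π.line_spec F.ne).1
  have hO : F.O ≠ B₁ := fun h => hB₁ (h ▸ π.left_mem_line F.O F.I)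
  obtain ⟨h1, -, h3⟩ := π.par_spec hℓ B₁
  obtain ⟨Y, hY, hY'⟩ := π.exists_mem_par hℓ (π.line_spec hO).1 h1 h3
    (π.not_parallel_line (π.left_mem_line _ _) hB₁) A.1
  exact ⟨Y, hY', hY⟩

theorem exists_prod_aux (A : π.Pt F) {B₁ : P} (hB₁ : B₁ ∉ π.line F.O F.I) :
    ∃ P₁ : P, P₁ ∈ π.par (π.line F.I B₁) A.1 ∧ P₁ ∈ π.line F.O B₁ := by
  have hO : F.O ≠ B₁ := fun h => hB₁ (h ▸ π.left_mem_line F.O F.I)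
  have hI : F.I ≠ B₁ := fun h => hB₁ (h ▸ π.right_mem_line F.O F.I)
  have hl := (π.line_spec hO).1
  refine π.exists_mem_par hl (π.line_spec hI).1 hl (Or.inl rfl) (fun h => hB₁ ?_) A.1
  have he := h.eq_of_mem (π.right_mem_line _ _) (π.right_mem_line _ _)
  rw [π.line_eq F.ne hl (π.left_mem_line _ _) (he ▸ π.left_mem_line _ _)]
  exact π.right_mem_line _ _

theorem exists_last_step (B : π.Pt F) {B₁ : P} (hB₁ : B₁ ∉ π.line F.O F.I) (P₁ : P) :
    ∃ C : π.Pt F, C.1 ∈ π.par (π.line B.1 B₁) P₁ := by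
  have hℓ := (π.line_spec F.ne).1
  have hB : B.1 ≠ B₁ := fun h => hB₁ (h ▸ B.2)
  obtain ⟨Y, hY, hY'⟩ := π.exists_mem_par hℓ (π.line_spec hB).1 hℓ (Or.inl rfl)
    (π.not_parallel_line B.2 hB₁) P₁
  exact ⟨⟨Y, hY'⟩, hY⟩

theorem exists_isSum (A B : π.Pt F) : ∃ C, IsSum A B C := by
  obtain ⟨B₁, hB₁⟩ := π.exists_notMem (π.line_spec F.ne).1
  obtain ⟨P₁, h1, h2⟩ := exists_sum_aux A hB₁
  obtain ⟨C, hC⟩ := exists_last_step B hB₁ P₁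
  exact ⟨C, B₁, hB₁, P₁, h1, h2, hC⟩

theorem exists_isProd (A B : π.Pt F) : ∃ C, IsProd A B C := by
  obtain ⟨B₁, hB₁⟩ := π.exists_notMem (π.line_spec F.ne).1
  obtain ⟨P₁, h1, h2⟩ := exists_prod_aux A hB₁
  obtain ⟨C, hC⟩ := exists_last_step B hB₁ P₁
  exact ⟨C, B₁, hB₁, P₁, h1, h2, hC⟩

/-- The last step of the two constructions can be solved for `B`. -/
theorem exists_solve_last_step (C : π.Pt F) {B₁ P₁ : P} (hB₁ : B₁ ∉ π.line F.O F.I)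
    (hP₁ : P₁ ∉ π.line F.O F.I) : ∃ B : π.Pt F, C.1 ∈ π.par (π.line B.1 B₁) P₁ := by
  have hℓ := (π.line_spec F.ne).1
  have hC : C.1 ≠ P₁ := fun h => hP₁ (h ▸ C.2)
  obtain ⟨k1, k2, k3⟩ := π.line_spec hC
  obtain ⟨Y, hY, hY'⟩ := π.exists_mem_par hℓ k1 hℓ (Or.inl rfl)
    (π.not_parallel_line C.2 hP₁) B₁
  obtain ⟨q1, q2, q3⟩ := π.par_spec k1 B₁
  have hYB : Y ≠ B₁ := fun h => hB₁ (h ▸ hY')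
  refine ⟨⟨Y, hY'⟩, ?_⟩
  rw [π.line_eq hYB q1 hY q2, π.par_eq q1 k1 k3 q3.symm]
  exact k2

theorem exists_isSum_zero (A : π.Pt F) : ∃ B, IsSum A B (zero π F) := by
  have hℓ := (π.line_spec F.ne).1
  obtain ⟨B₁, hB₁⟩ := π.exists_notMem hℓ
  obtain ⟨P₁, h1, h2⟩ := exists_sum_aux A hB₁
  obtain ⟨-, q2, q3⟩ := π.par_spec hℓ B₁
  obtain ⟨B, hB⟩ := exists_solve_last_step (zero π F) hB₁
    (fun h : P₁ ∈ π.line F.O F.I => hB₁ (q3.eq_of_mem h1 h ▸ q2))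
  exact ⟨B, B₁, hB₁, P₁, h1, h2, hB⟩

theorem exists_isProd_one (A : π.Pt F) (hA : A ≠ zero π F) : ∃ B, IsProd A B (one π F) := by
  have hℓ := (π.line_spec F.ne).1
  obtain ⟨B₁, hB₁⟩ := π.exists_notMem hℓ
  have hO : F.O ≠ B₁ := fun h => hB₁ (h ▸ π.left_mem_line F.O F.I)
  have hI : F.I ≠ B₁ := fun h => hB₁ (h ▸ π.right_mem_line F.O F.I)
  obtain ⟨P₁, h1, h2⟩ := exists_prod_aux A hB₁
  have hP₁ : P₁ ∉ π.line F.O F.I := by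
    intro h
    have hPO : P₁ = F.O := by
      by_contra hne
      apply hB₁
      rw [← π.line_eq hne hℓ h (π.left_mem_line _ _),
        π.line_eq hne (π.line_spec hO).1 h2 (π.left_mem_line _ _)]
      exact π.right_mem_line _ _
    subst hPO
    obtain ⟨q1, q2, q3⟩ := π.par_spec (π.line_spec hI).1 A.1
    have hne : A.1 ≠ F.O := fun h => hA (Subtype.ext h)
    have e : π.par (π.line F.I B₁) A.1 = π.line F.O F.I := by
      rw [← π.line_eq hne q1 q2 h1, π.line_eq hne hℓ A.2 (π.left_mem_line _ _)]
    rw [e] at q3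
    exact π.not_parallel_line (π.right_mem_line _ _) hB₁ q3.symm
  obtain ⟨B, hB⟩ := exists_solve_last_step (one π F) hB₁ hP₁
  exact ⟨B, B₁, hB₁, P₁, h1, h2, hB⟩

/-- Addition of points of `ℓ^{OI}`. -/
noncomputable def add (A B : π.Pt F) : π.Pt F := (exists_isSum A B).choose

/-- Multiplication of points of `ℓ^{OI}`. -/
noncomputable def mul (A B : π.Pt F) : π.Pt F := (exists_isProd A B).choose

/-- The opposite `-A`: the point `B` of `ℓ^{OI}` such that the addition construction gives
`A + B = O`. -/
noncomputable def neg (A : π.Pt F) : π.Pt F := (exists_isSum_zero A).choose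

open Classical in
/-- The inverse `A⁻¹` of a point `A ≠ O`: the point `B` of `ℓ^{OI}` such that the multiplication
construction gives `A · B = I`. (The value `O` at `A = O` is a convention.) -/
noncomputable def inv (A : π.Pt F) : π.Pt F :=
  if hA : A = zero π F then zero π F else (exists_isProd_one A hA).choose

/-- Subtraction of points of `ℓ^{OI}`: `A - B = A + (-B)`. -/
noncomputable def sub (A B : π.Pt F) : π.Pt F := add A (neg B)

/-- The ratio `r(A, B; C) = (B - C)⁻¹ · (A - C)` of three points of `ℓ^{OI}`, `B ≠ C`. -/
noncomputable def ratio (A B C : π.Pt F) : π.Pt F := mul (inv (sub B C)) (sub A C)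

end Skewfield

/-- A collineation: a bijection of the set of points that maps lines to lines. -/
def IsCollineation {P : Type*} (π : AffinePlane P) (δ : P ≃ P) : Prop :=
  ∀ ℓ ∈ π.lines, δ '' ℓ ∈ π.lines

/-- A dilatation: a collineation `δ` such that `δ(PQ) ∥ PQ` for all points `P ≠ Q`. -/
structure IsDilatation {P : Type*} (π : AffinePlane P) (δ : P ≃ P) : Prop where
  collineation : π.IsCollineation δ
  parallel : ∀ A B : P, A ≠ B → Parallel (δ '' π.line A B) (π.line A B)

/-- The image frame `(δ(O), δ(I))`. -/
def Frame.map {P : Type*} (δ : P ≃ P) (F : Frame P) : Frame P :=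
  ⟨δ F.O, δ F.I, fun h => F.ne (δ.injective h)⟩

/-- A dilatation maps the points of `ℓ^{OI}` to points of the line through `δ(O)` and `δ(I)`. -/
def IsDilatation.mapPt {P : Type*} {π : AffinePlane P} {δ : P ≃ P} (hδ : π.IsDilatation δ)
    {F : Frame P} (A : π.Pt F) : π.Pt (F.map δ) :=
  ⟨δ A.1, by
    have h := (π.line_spec F.ne)
    rw [π.line_eq (F.map δ).ne (hδ.collineation _ h.1) ⟨_, h.2.1, rfl⟩ ⟨_, h.2.2, rfl⟩]
    exact ⟨_, A.2, rfl⟩⟩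

end AffinePlane

/-!
The ratio is built from the incidence constructions `IsSum` and `IsProd`, and a collineation carries
such a construction in `ℓ^{OI}` to the same construction in the image line (`IsSum.mapPt`,
`IsProd.mapPt`). The operations `add`, `mul`, `neg`, `inv`, however, are results of *some*
construction, with a chosen auxiliary point. So the content of the theorem is that the result of a
construction does not depend on the auxiliary point (`IsSum.unique`, `IsProd.unique`), and likewise
for the equations `A + B = O` and `A · B = I` in the unknown `B` (`IsSum.unique_right`,
`IsProd.unique_right`). This is where Desargues' axiom enters.

Let `B₁`, `B₁'` be auxiliary points, with corresponding points `P₁`, `P₁'`. For sums, assume that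
`ℓ^{OI}` and its parallels through `B₁` and `B₁'` are distinct. The axiom for these three parallels
and the triangles `B₁ O B₁'`, `P₁ A P₁'` gives `B₁B₁' ∥ P₁P₁'`; a second application to
`B B₁ B₁'`, `C P₁ P₁'` gives `BB₁' ∥ CP₁'`, so `B₁'` yields the same point `C` (`SumVia.move`). For
products the same argument works with the three lines `OI`, `OB₁`, `OB₁'` through `O`, and the
triangles `B₁ I B₁'`, `P₁ A P₁'` in the first step (`ProdVia.move`). If two of the three lines
coincide, one passes through a third auxiliary point. Such a point always exists for products; for
sums it fails to exist only if the plane is covered by two parallel lines, and then these lines have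
two points each and the sum is determined by `C ≠ B` (`eq_of_cover`).
-/

namespace AffinePlane

/-! ### Lines and parallels -/

section Incidence

variable {P : Type*} (π : AffinePlane P)

theorem line_comm (A B : P) : π.line A B = π.line B A := by
  simp only [line, and_comm]

theorem eq_of_mem_inter {ℓ m : Set P} (hℓ : ℓ ∈ π.lines) (hm : m ∈ π.lines) (h : ℓ ≠ m) {X Y : P}
    (hX : X ∈ ℓ) (hX' : X ∈ m) (hY : Y ∈ ℓ) (hY' : Y ∈ m) : X = Y := by
  by_contra hne
  exact h ((π.line_eq hne hℓ hX hY).symm.trans (π.line_eq hne hm hX' hY'))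

theorem parallel_line_of_mem_par {ℓ : Set P} (hℓ : ℓ ∈ π.lines) {X Y : P} (h : X ≠ Y)
    (hY : Y ∈ π.par ℓ X) : Parallel ℓ (π.line X Y) := by
  obtain ⟨h1, h2, h3⟩ := π.par_spec hℓ X
  rw [π.line_eq h h1 h2 hY]
  exact h3.symm

theorem mem_par_of_parallel_line {ℓ : Set P} (hℓ : ℓ ∈ π.lines) {X Y : P} (h : X ≠ Y)
    (hp : Parallel ℓ (π.line X Y)) : Y ∈ π.par ℓ X := by
  obtain ⟨h1, h2, h3⟩ := π.line_spec h
  rw [π.par_eq hℓ h1 h2 hp.symm]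
  exact h3

theorem par_eq_par_of_mem {ℓ : Set P} (hℓ : ℓ ∈ π.lines) {X Y : P} (hY : Y ∈ π.par ℓ X) :
    π.par ℓ Y = π.par ℓ X := by
  obtain ⟨h1, -, h3⟩ := π.par_spec hℓ X
  exact π.par_eq hℓ h1 hY h3

theorem par_eq_self {ℓ : Set P} (hℓ : ℓ ∈ π.lines) {X : P} (hX : X ∈ ℓ) : π.par ℓ X = ℓ :=
  π.par_eq hℓ hℓ hX (Or.inl rfl)

theorem notMem_of_mem_par {ℓ : Set P} (hℓ : ℓ ∈ π.lines) {X Y : P} (hX : X ∉ ℓ)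
    (hY : Y ∈ π.par ℓ X) : Y ∉ ℓ := fun h => by
  obtain ⟨-, h2, h3⟩ := π.par_spec hℓ X
  exact hX (h3.eq_of_mem hY h ▸ h2)

/-- A line `ℓ` meets each parallel to a line `XY`, `X ∈ ℓ`, `Y ∉ ℓ`, in at most one point. -/
theorem eq_of_mem_par {ℓ : Set P} (hℓ : ℓ ∈ π.lines) {X Y Z C C' : P} (hX : X ∈ ℓ) (hY : Y ∉ ℓ)
    (hC : C ∈ ℓ) (hC' : C' ∈ ℓ) (h : C ∈ π.par (π.line X Y) Z) (h' : C' ∈ π.par (π.line X Y) Z) :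
    C = C' := by
  have hXY : X ≠ Y := fun h => hY (h ▸ hX)
  obtain ⟨h1, -, h3⟩ := π.par_spec (π.line_spec hXY).1 Z
  refine π.eq_of_mem_inter hℓ h1 (fun he => ?_) hC h hC' h'
  rw [← he] at h3
  exact π.not_parallel_line hX hY h3.symm

/-- The last step of both constructions can be solved for the second operand in one way only: if the
parallels to `XY` and `X'Y` through `Z` have a common point other than `Z`, then `X = X'`. -/
theorem eq_of_mem_par_of_mem_par {ℓ : Set P} (hℓ : ℓ ∈ π.lines) {X X' Y Z C : P} (hX : X ∈ ℓ)
    (hX' : X' ∈ ℓ) (hY : Y ∉ ℓ) (hZ : Z ≠ C) (h : C ∈ π.par (π.line X Y) Z)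
    (h' : C ∈ π.par (π.line X' Y) Z) : X = X' := by
  have hXY : X ≠ Y := fun h => hY (h ▸ hX)
  have hXY' : X' ≠ Y := fun h => hY (h ▸ hX')
  have l1 := (π.line_spec hXY).1
  have l2 := (π.line_spec hXY').1
  have p1 := π.parallel_line_of_mem_par l1 hZ h
  have p2 := π.parallel_line_of_mem_par l2 hZ h'
  have he := (π.parallel_trans l1 (π.line_spec hZ).1 l2 p1 p2.symm).eq_of_mem
    (π.right_mem_line _ _) (π.right_mem_line _ _)
  refine π.eq_of_mem_inter hℓ l1 (fun h => hY (h ▸ π.right_mem_line X Y)) hX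
    (π.left_mem_line _ _) hX' (he ▸ π.left_mem_line _ _)

variable {π} in
/-- Desargues' axiom with the sides of the two triangles written as `line`s. -/
theorem Desargues.parallel_line (hπ : π.Desargues) {A B C A' B' C' : P} {ℓ₁ ℓ₂ ℓ₃ : Set P}
    (l₁ : ℓ₁ ∈ π.lines) (l₂ : ℓ₂ ∈ π.lines) (l₃ : ℓ₃ ∈ π.lines)
    (h₁₂ : ℓ₁ ≠ ℓ₂) (h₂₃ : ℓ₂ ≠ ℓ₃) (h₁₃ : ℓ₁ ≠ ℓ₃)
    (hl : (Parallel ℓ₁ ℓ₂ ∧ Parallel ℓ₂ ℓ₃) ∨ ∃ V : P, V ∈ ℓ₁ ∧ V ∈ ℓ₂ ∧ V ∈ ℓ₃)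
    (hA : A ∈ ℓ₁) (hA' : A' ∈ ℓ₁) (hB : B ∈ ℓ₂) (hB' : B' ∈ ℓ₂) (hC : C ∈ ℓ₃) (hC' : C' ∈ ℓ₃)
    (nA : A ≠ A') (nB : B ≠ B') (nC : C ≠ C') (nAB : A ≠ B) (nBC : B ≠ C) (nAC : A ≠ C)
    (nAB' : A' ≠ B') (nBC' : B' ≠ C') (nAC' : A' ≠ C')
    (hc : Parallel (π.line A B) (π.line A' B')) (ha : Parallel (π.line B C) (π.line B' C')) :
    Parallel (π.line A C) (π.line A' C') :=
  hπ A B C A' B' C' nA nB nC ℓ₁ l₁ ℓ₂ l₂ ℓ₃ l₃ h₁₂ h₂₃ h₁₃ hA hA' hB hB' hC hC' hl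
    nAB nBC nAC nAB' nBC' nAC' _ (π.line_spec nAB).1 _ (π.line_spec nAB').1
    _ (π.line_spec nBC).1 _ (π.line_spec nBC').1 _ (π.line_spec nAC).1 _ (π.line_spec nAC').1
    (π.left_mem_line _ _) (π.right_mem_line _ _) (π.left_mem_line _ _) (π.right_mem_line _ _)
    (π.left_mem_line _ _) (π.right_mem_line _ _) (π.left_mem_line _ _) (π.right_mem_line _ _)
    (π.left_mem_line _ _) (π.right_mem_line _ _) (π.left_mem_line _ _) (π.right_mem_line _ _)
    hc ha

/-- If two disjoint lines cover the plane, then they have at most two points each: for `X ≠ Y, Z`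
on the first line and `Q ≠ Q'` on the second one, `YQ'` and `ZQ'` are both parallel to `XQ`. -/
theorem eq_of_cover {ℓ m : Set P} (hℓ : ℓ ∈ π.lines) (hm : m ∈ π.lines)
    (hd : ∀ W, W ∈ m → W ∉ ℓ) (hcov : ∀ W, W ∈ ℓ ∨ W ∈ m) {Q Q' : P} (hQ : Q ∈ m) (hQ' : Q' ∈ m)
    (hne : Q ≠ Q') {X Y Z : P} (hX : X ∈ ℓ) (hY : Y ∈ ℓ) (hZ : Z ∈ ℓ) (hXY : X ≠ Y)
    (hXZ : X ≠ Z) : Y = Z := by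
  have nXQ : X ≠ Q := fun h => hd Q hQ (h ▸ hX)
  have lXQ := (π.line_spec nXQ).1
  have key : ∀ T, T ∈ ℓ → X ≠ T → Parallel (π.line T Q') (π.line X Q) := by
    intro T hT hXT
    have nTQ : T ≠ Q' := fun h => hd Q' hQ' (h ▸ hT)
    have lTQ := (π.line_spec nTQ).1
    by_contra hc
    obtain ⟨W, hW, hW'⟩ := exists_of_not_parallel hc
    rcases hcov W with h | h
    · have e1 := π.eq_of_mem_inter hℓ lTQ (fun e => hd Q' hQ' (e ▸ π.right_mem_line T Q')) h hW
        hT (π.left_mem_line _ _)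
      have e2 := π.eq_of_mem_inter hℓ lXQ (fun e => hd Q hQ (e ▸ π.right_mem_line X Q)) h hW'
        hX (π.left_mem_line _ _)
      exact hXT (e2.symm.trans e1)
    · have e1 := π.eq_of_mem_inter hm lTQ (fun e => hd T (e ▸ π.left_mem_line T Q') hT) h hW
        hQ' (π.right_mem_line _ _)
      have e2 := π.eq_of_mem_inter hm lXQ (fun e => hd X (e ▸ π.left_mem_line X Q) hX) h hW'
        hQ (π.right_mem_line _ _)
      exact hne (e2.symm.trans e1)
  have nYQ : Y ≠ Q' := fun h => hd Q' hQ' (h ▸ hY)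
  have nZQ : Z ≠ Q' := fun h => hd Q' hQ' (h ▸ hZ)
  have he := π.eq_of_parallel lXQ (π.line_spec nYQ).1 (π.line_spec nZQ).1
    (π.right_mem_line _ _) (π.right_mem_line _ _) (key Y hY hXY) (key Z hZ hXZ)
  exact π.eq_of_mem_inter hℓ (π.line_spec nYQ).1 (fun e => hd Q' hQ' (e ▸ π.right_mem_line Y Q'))
    hY (π.left_mem_line _ _) hZ (he ▸ π.left_mem_line _ _)

end Incidence

/-! ### Independence of sums from the auxiliary point -/

section Sum

variable {P : Type*} {π : AffinePlane P} {F : Frame P}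

/-- `C` is obtained from `A` and `B` by the addition construction with the auxiliary point `B₁`. -/
def SumVia (B₁ : P) (A B C : π.Pt F) : Prop :=
  ∃ P₁ : P, P₁ ∈ π.par (π.line F.O F.I) B₁ ∧ P₁ ∈ π.par (π.line F.O B₁) A.1 ∧
    C.1 ∈ π.par (π.line B.1 B₁) P₁

theorem exists_sumVia {B₁ : P} (h : B₁ ∉ π.line F.O F.I) (A B : π.Pt F) :
    ∃ C, SumVia B₁ A B C := by
  obtain ⟨P₁, h1, h2⟩ := exists_sum_aux A h
  obtain ⟨C, hC⟩ := exists_last_step B h P₁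
  exact ⟨C, P₁, h1, h2, hC⟩

theorem sum_aux_unique {B₁ P₁ P₁' : P} (h : B₁ ∉ π.line F.O F.I) {A : π.Pt F}
    (h1 : P₁ ∈ π.par (π.line F.O F.I) B₁) (h2 : P₁ ∈ π.par (π.line F.O B₁) A.1)
    (h1' : P₁' ∈ π.par (π.line F.O F.I) B₁) (h2' : P₁' ∈ π.par (π.line F.O B₁) A.1) :
    P₁ = P₁' := by
  have hℓ := (π.line_spec F.ne).1
  have hO : F.O ≠ B₁ := fun e => h (e ▸ π.left_mem_line F.O F.I)
  obtain ⟨p1, -, -⟩ := π.par_spec hℓ B₁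
  obtain ⟨q1, q2, -⟩ := π.par_spec (π.line_spec hO).1 A.1
  refine π.eq_of_mem_inter p1 q1 (fun e => ?_) h1 h2 h1' h2'
  exact π.notMem_of_mem_par hℓ h (e ▸ q2) A.2

theorem SumVia.unique {B₁ : P} (h : B₁ ∉ π.line F.O F.I) {A B C C' : π.Pt F}
    (hC : SumVia B₁ A B C) (hC' : SumVia B₁ A B C') : C = C' := by
  obtain ⟨P₁, h1, h2, h3⟩ := hC
  obtain ⟨P₁', h1', h2', h3'⟩ := hC'
  obtain rfl := sum_aux_unique h h1 h2 h1' h2'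
  exact Subtype.ext (π.eq_of_mem_par (π.line_spec F.ne).1 B.2 h C.2 C'.2 h3 h3')

theorem SumVia.unique_right {B₁ : P} (h : B₁ ∉ π.line F.O F.I) {A B B' C : π.Pt F}
    (hC : SumVia B₁ A B C) (hC' : SumVia B₁ A B' C) : B = B' := by
  have hℓ := (π.line_spec F.ne).1
  obtain ⟨P₁, h1, h2, h3⟩ := hC
  obtain ⟨P₁', h1', h2', h3'⟩ := hC'
  obtain rfl := sum_aux_unique h h1 h2 h1' h2'
  exact Subtype.ext (π.eq_of_mem_par_of_mem_par hℓ B.2 B'.2 h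
    (fun e : P₁ = C.1 => π.notMem_of_mem_par hℓ h h1 (e ▸ C.2)) h3 h3')

/-- `O + B = B`, whatever the auxiliary point. -/
theorem SumVia.zero_left {B₁ : P} (h : B₁ ∉ π.line F.O F.I) {B C : π.Pt F}
    (hC : SumVia B₁ (zero π F) B C) : C = B := by
  have hℓ := (π.line_spec F.ne).1
  have hO : F.O ≠ B₁ := fun e => h (e ▸ π.left_mem_line F.O F.I)
  have hB : B.1 ≠ B₁ := fun e => h (e ▸ B.2)
  refine hC.unique h ⟨B₁, (π.par_spec hℓ B₁).2.1, ?_, ?_⟩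
  · exact π.mem_par_of_parallel_line (π.line_spec hO).1 hO (Or.inl rfl)
  · rw [π.par_eq_self (π.line_spec hB).1 (π.right_mem_line _ _)]
    exact π.left_mem_line _ _

theorem sum_aux_ne {B₁ P₁ : P} (h : B₁ ∉ π.line F.O F.I) {A : π.Pt F} (hA : A ≠ zero π F)
    (h2 : P₁ ∈ π.par (π.line F.O B₁) A.1) : B₁ ≠ P₁ := by
  rintro rfl
  have hℓ := (π.line_spec F.ne).1
  have hO : F.O ≠ B₁ := fun e => h (e ▸ π.left_mem_line F.O F.I)
  obtain ⟨l1, l2, l3⟩ := π.line_spec hO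
  have e := (π.par_spec l1 A.1).2.2.eq_of_mem h2 l3
  exact hA (Subtype.ext (π.eq_of_mem_inter hℓ l1 (fun e' => h (e' ▸ l3)) A.2
    (e ▸ (π.par_spec l1 A.1).2.1) (π.left_mem_line _ _) l2))

theorem SumVia.right_ne {B₁ : P} (h : B₁ ∉ π.line F.O F.I) {A B C : π.Pt F}
    (hA : A ≠ zero π F) (hC : SumVia B₁ A B C) : B ≠ C := by
  rintro rfl
  obtain ⟨P₁, h1, h2, h3⟩ := hC
  have hℓ := (π.line_spec F.ne).1
  have hB : B.1 ≠ B₁ := fun e => h (e ▸ B.2)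
  obtain ⟨l1, l2, l3⟩ := π.line_spec hB
  obtain ⟨p1, p2, -⟩ := π.par_spec hℓ B₁
  -- both `B₁` and `P₁` are on the line `BB₁` and on the parallel to `OI` through `B₁`
  have e := (π.par_spec l1 P₁).2.2.eq_of_mem h3 l2
  refine sum_aux_ne h hA h2 (π.eq_of_mem_inter p1 l1 (fun e' => ?_) p2 l3 h1
    (e ▸ (π.par_spec l1 P₁).2.1))
  exact π.notMem_of_mem_par hℓ h (e' ▸ l2) B.2

/-- Change of the auxiliary point in a sum, for auxiliary points on different parallels to `OI`. -/
theorem SumVia.move (hπ : π.Desargues) {B₁ B₂ : P} (h₁ : B₁ ∉ π.line F.O F.I)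
    (h₂ : B₂ ∉ π.line F.O F.I) (h₁₂ : B₂ ∉ π.par (π.line F.O F.I) B₁) {A B C : π.Pt F}
    (hA : A ≠ zero π F) (hC : SumVia B₁ A B C) : SumVia B₂ A B C := by
  have hℓ := (π.line_spec F.ne).1
  have nBC : B.1 ≠ C.1 := fun e => hC.right_ne h₁ hA (Subtype.ext e)
  obtain ⟨P₁, p1, p2, p3⟩ := hC
  obtain ⟨P₂, q1, q2⟩ := exists_sum_aux A h₂
  refine ⟨P₂, q1, q2, ?_⟩
  have notMem_P₁ := π.notMem_of_mem_par hℓ h₁ p1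
  have notMem_P₂ := π.notMem_of_mem_par hℓ h₂ q1
  obtain ⟨l₁, m₁, par₁⟩ := π.par_spec hℓ B₁
  obtain ⟨l₂, m₂, par₂⟩ := π.par_spec hℓ B₂
  have ne_of : ∀ {X Y : P}, X ∈ π.line F.O F.I → Y ∉ π.line F.O F.I → X ≠ Y :=
    fun hX hY e => hY (e ▸ hX)
  have mO : F.O ∈ π.line F.O F.I := π.left_mem_line _ _
  have nm : π.par (π.line F.O F.I) B₁ ≠ π.par (π.line F.O F.I) B₂ := fun e => h₁₂ (e ▸ m₂)
  have n₁ : π.line F.O F.I ≠ π.par (π.line F.O F.I) B₁ := fun e => h₁ (e ▸ m₁)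
  have n₂ : π.line F.O F.I ≠ π.par (π.line F.O F.I) B₂ := fun e => h₂ (e ▸ m₂)
  have nB : B₁ ≠ B₂ := fun e => h₁₂ (e ▸ m₁)
  have par₁₂ := π.parallel_trans l₁ hℓ l₂ par₁ par₂.symm
  have nP : P₁ ≠ P₂ := fun e => nm (par₁₂.eq_of_mem p1 (e ▸ q1))
  have nBP₁ := sum_aux_ne h₁ hA p2
  have nBP₂ := sum_aux_ne h₂ hA q2
  have s₁ := π.parallel_line_of_mem_par (π.line_spec (ne_of mO h₁)).1 (ne_of A.2 notMem_P₁) p2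
  have s₂ := π.parallel_line_of_mem_par (π.line_spec (ne_of mO h₂)).1 (ne_of A.2 notMem_P₂) q2
  rw [π.line_comm F.O, π.line_comm A.1] at s₁
  have t := hπ.parallel_line l₁ hℓ l₂ n₁.symm n₂ nm (Or.inl ⟨par₁, par₂.symm⟩) m₁ p1 mO A.2 m₂ q1
    nBP₁ (fun e => hA (Subtype.ext e.symm)) nBP₂ (ne_of mO h₁).symm (ne_of mO h₂) nB
    (ne_of A.2 notMem_P₁).symm (ne_of A.2 notMem_P₂) nP s₁ s₂
  have s₃ := π.parallel_line_of_mem_par (π.line_spec (ne_of B.2 h₁)).1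
    (ne_of C.2 notMem_P₁).symm p3
  rw [π.line_comm P₁] at s₃
  have u := hπ.parallel_line hℓ l₁ l₂ n₁ nm n₂ (Or.inl ⟨par₁.symm, par₁₂⟩) B.2 C.2 m₁ p1 m₂ q1
    nBC nBP₁ nBP₂ (ne_of B.2 h₁) nB (ne_of B.2 h₂) (ne_of C.2 notMem_P₁) nP
    (ne_of C.2 notMem_P₂) s₃ t
  rw [π.line_comm C.1] at u
  exact π.mem_par_of_parallel_line (π.line_spec (ne_of B.2 h₂)).1 (ne_of C.2 notMem_P₂).symm u

/-- The sum does not depend on the auxiliary point. -/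
theorem SumVia.congr (hπ : π.Desargues) {B₁ B₂ : P} (h₁ : B₁ ∉ π.line F.O F.I)
    (h₂ : B₂ ∉ π.line F.O F.I) {A B C : π.Pt F} (hC : SumVia B₁ A B C) : SumVia B₂ A B C := by
  have hℓ := (π.line_spec F.ne).1
  by_cases hA : A = zero π F
  · subst hA
    obtain ⟨C', hC'⟩ := exists_sumVia h₂ (zero π F) B
    exact ((hC.zero_left h₁).trans (hC'.zero_left h₂).symm) ▸ hC'
  by_cases h₁₂ : B₂ ∈ π.par (π.line F.O F.I) B₁
  · have e₁₂ := π.par_eq_par_of_mem hℓ h₁₂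
    by_cases hex : ∃ B₃, B₃ ∉ π.line F.O F.I ∧ B₃ ∉ π.par (π.line F.O F.I) B₁
    · obtain ⟨B₃, h₃, h₁₃⟩ := hex
      refine (hC.move hπ h₁ h₃ h₁₃ hA).move hπ h₃ h₂ (fun h => h₁₃ ?_) hA
      rw [← e₁₂, π.par_eq_par_of_mem hℓ h]
      exact (π.par_spec hℓ B₃).2.1
    · -- the two parallels cover the plane, and `C` is the point of `OI` other than `B`
      by_cases nB : B₁ = B₂
      · rwa [← nB]
      have hcov : ∀ W, W ∈ π.line F.O F.I ∨ W ∈ π.par (π.line F.O F.I) B₁ := by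
        intro W
        by_contra hW
        exact hex ⟨W, not_or.mp hW⟩
      obtain ⟨C', hC'⟩ := exists_sumVia h₂ A B
      obtain ⟨l₁, m₁, -⟩ := π.par_spec hℓ B₁
      have e : C = C' := Subtype.ext (π.eq_of_cover hℓ l₁
        (fun W hW => π.notMem_of_mem_par hℓ h₁ hW) hcov m₁ h₁₂ nB B.2 C.2 C'.2
        (fun e => hC.right_ne h₁ hA (Subtype.ext e))
        (fun e => hC'.right_ne h₂ hA (Subtype.ext e)))
      rwa [e]
  · exact hC.move hπ h₁ h₂ h₁₂ hA

theorem IsSum.unique (hπ : π.Desargues) {A B C C' : π.Pt F} (h : IsSum A B C)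
    (h' : IsSum A B C') : C = C' := by
  obtain ⟨B₁, h₁, hC⟩ := h
  obtain ⟨B₂, h₂, hC'⟩ := h'
  exact SumVia.unique h₂ (SumVia.congr hπ h₁ h₂ hC) hC'

theorem IsSum.unique_right (hπ : π.Desargues) {A B B' C : π.Pt F} (h : IsSum A B C)
    (h' : IsSum A B' C) : B = B' := by
  obtain ⟨B₁, h₁, hC⟩ := h
  obtain ⟨B₂, h₂, hC'⟩ := h'
  exact SumVia.unique_right h₂ (SumVia.congr hπ h₁ h₂ hC) hC'

end Sum

/-! ### Independence of products from the auxiliary point -/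

section Prod

variable {P : Type*} {π : AffinePlane P} {F : Frame P}

/-- `C` is obtained from `A` and `B` by the multiplication construction with the auxiliary
point `B₁`. -/
def ProdVia (B₁ : P) (A B C : π.Pt F) : Prop :=
  ∃ P₁ : P, P₁ ∈ π.par (π.line F.I B₁) A.1 ∧ P₁ ∈ π.line F.O B₁ ∧
    C.1 ∈ π.par (π.line B.1 B₁) P₁

theorem exists_prodVia {B₁ : P} (h : B₁ ∉ π.line F.O F.I) (A B : π.Pt F) :
    ∃ C, ProdVia B₁ A B C := by
  obtain ⟨P₁, h1, h2⟩ := exists_prod_aux A h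
  obtain ⟨C, hC⟩ := exists_last_step B h P₁
  exact ⟨C, P₁, h1, h2, hC⟩

/-- The lines `OI` and `OB₁` meet only in `O`. -/
theorem eq_zero_of_mem {B₁ X : P} (h : B₁ ∉ π.line F.O F.I) (hX : X ∈ π.line F.O F.I)
    (hX' : X ∈ π.line F.O B₁) : X = F.O := by
  have hO : F.O ≠ B₁ := fun e => h (e ▸ π.left_mem_line F.O F.I)
  exact π.eq_of_mem_inter (π.line_spec F.ne).1 (π.line_spec hO).1
    (fun e => h (e ▸ π.right_mem_line F.O B₁)) hX hX' (π.left_mem_line _ _) (π.left_mem_line _ _)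

theorem prod_aux_unique {B₁ P₁ P₁' : P} (h : B₁ ∉ π.line F.O F.I) {A : π.Pt F}
    (h1 : P₁ ∈ π.par (π.line F.I B₁) A.1) (h2 : P₁ ∈ π.line F.O B₁)
    (h1' : P₁' ∈ π.par (π.line F.I B₁) A.1) (h2' : P₁' ∈ π.line F.O B₁) : P₁ = P₁' := by
  have hO : F.O ≠ B₁ := fun e => h (e ▸ π.left_mem_line F.O F.I)
  have hI : F.I ≠ B₁ := fun e => h (e ▸ π.right_mem_line F.O F.I)
  obtain ⟨q1, -, q3⟩ := π.par_spec (π.line_spec hI).1 A.1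
  refine π.eq_of_mem_inter q1 (π.line_spec hO).1 (fun e => ?_) h1 h2 h1' h2'
  rw [e] at q3
  have e' := q3.eq_of_mem (π.right_mem_line _ _) (π.right_mem_line _ _)
  exact F.ne (eq_zero_of_mem h (π.right_mem_line _ _) (e' ▸ π.left_mem_line F.I B₁)).symm

theorem prod_aux_notMem {B₁ P₁ : P} (h : B₁ ∉ π.line F.O F.I) {A : π.Pt F} (hA : A ≠ zero π F)
    (h1 : P₁ ∈ π.par (π.line F.I B₁) A.1) (h2 : P₁ ∈ π.line F.O B₁) : P₁ ∉ π.line F.O F.I := by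
  intro hP
  have hI : F.I ≠ B₁ := fun e => h (e ▸ π.right_mem_line F.O F.I)
  have e := π.eq_of_mem_par (π.line_spec F.ne).1 (π.right_mem_line _ _) h A.2 hP
    (π.par_spec (π.line_spec hI).1 A.1).2.1 h1
  exact hA (Subtype.ext (e.trans (eq_zero_of_mem h hP h2)))

theorem ProdVia.unique {B₁ : P} (h : B₁ ∉ π.line F.O F.I) {A B C C' : π.Pt F}
    (hC : ProdVia B₁ A B C) (hC' : ProdVia B₁ A B C') : C = C' := by
  obtain ⟨P₁, h1, h2, h3⟩ := hC
  obtain ⟨P₁', h1', h2', h3'⟩ := hC'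
  obtain rfl := prod_aux_unique h h1 h2 h1' h2'
  exact Subtype.ext (π.eq_of_mem_par (π.line_spec F.ne).1 B.2 h C.2 C'.2 h3 h3')

theorem ProdVia.unique_right {B₁ : P} (h : B₁ ∉ π.line F.O F.I) {A B B' C : π.Pt F}
    (hA : A ≠ zero π F) (hC : ProdVia B₁ A B C) (hC' : ProdVia B₁ A B' C) : B = B' := by
  obtain ⟨P₁, h1, h2, h3⟩ := hC
  obtain ⟨P₁', h1', h2', h3'⟩ := hC'
  obtain rfl := prod_aux_unique h h1 h2 h1' h2'
  exact Subtype.ext (π.eq_of_mem_par_of_mem_par (π.line_spec F.ne).1 B.2 B'.2 h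
    (fun e : P₁ = C.1 => prod_aux_notMem h hA h1 h2 (e ▸ C.2)) h3 h3')

/-- `O · B = O`, whatever the auxiliary point. -/
theorem ProdVia.zero_left {B₁ : P} (h : B₁ ∉ π.line F.O F.I) {B C : π.Pt F}
    (hC : ProdVia B₁ (zero π F) B C) : C = zero π F := by
  have hI : F.I ≠ B₁ := fun e => h (e ▸ π.right_mem_line F.O F.I)
  have hB : B.1 ≠ B₁ := fun e => h (e ▸ B.2)
  exact hC.unique h ⟨F.O, (π.par_spec (π.line_spec hI).1 _).2.1, π.left_mem_line _ _,
    (π.par_spec (π.line_spec hB).1 _).2.1⟩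

/-- `A · O = O`, whatever the auxiliary point. -/
theorem ProdVia.zero_right {B₁ : P} (h : B₁ ∉ π.line F.O F.I) {A C : π.Pt F}
    (hC : ProdVia B₁ A (zero π F) C) : C = zero π F := by
  have hO : F.O ≠ B₁ := fun e => h (e ▸ π.left_mem_line F.O F.I)
  obtain ⟨P₁, h1, h2⟩ := exists_prod_aux A h
  refine hC.unique h ⟨P₁, h1, h2, ?_⟩
  rw [show (zero π F).1 = F.O from rfl, π.par_eq_self (π.line_spec hO).1 h2]
  exact π.left_mem_line _ _

/-- `I · B = B`, whatever the auxiliary point. -/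
theorem ProdVia.one_left {B₁ : P} (h : B₁ ∉ π.line F.O F.I) {B C : π.Pt F}
    (hC : ProdVia B₁ (one π F) B C) : C = B := by
  have hI : F.I ≠ B₁ := fun e => h (e ▸ π.right_mem_line F.O F.I)
  have hB : B.1 ≠ B₁ := fun e => h (e ▸ B.2)
  refine hC.unique h ⟨B₁, ?_, π.right_mem_line _ _, ?_⟩
  · exact π.mem_par_of_parallel_line (π.line_spec hI).1 hI (Or.inl rfl)
  · rw [π.par_eq_self (π.line_spec hB).1 (π.right_mem_line _ _)]
    exact π.left_mem_line _ _

theorem prod_aux_ne {B₁ P₁ : P} (h : B₁ ∉ π.line F.O F.I) {A : π.Pt F} (hA : A ≠ one π F)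
    (h1 : P₁ ∈ π.par (π.line F.I B₁) A.1) : B₁ ≠ P₁ := by
  rintro rfl
  have hI : F.I ≠ B₁ := fun e => h (e ▸ π.right_mem_line F.O F.I)
  obtain ⟨l1, l2, l3⟩ := π.line_spec hI
  have e := (π.par_spec l1 A.1).2.2.eq_of_mem h1 l3
  exact hA (Subtype.ext (π.eq_of_mem_inter (π.line_spec F.ne).1 l1 (fun e' => h (e' ▸ l3)) A.2
    (e ▸ (π.par_spec l1 A.1).2.1) (π.right_mem_line _ _) l2))

/-- Change of the auxiliary point in a product, for auxiliary points that are not collinear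
with `O`. -/
theorem ProdVia.move (hπ : π.Desargues) {B₁ B₂ : P} (h₁ : B₁ ∉ π.line F.O F.I)
    (h₂ : B₂ ∉ π.line F.O F.I) (h₁₂ : B₂ ∉ π.line F.O B₁) {A B C : π.Pt F}
    (hA : A ≠ zero π F) (hA' : A ≠ one π F) (hB : B ≠ zero π F) (hC : ProdVia B₁ A B C) :
    ProdVia B₂ A B C := by
  have hℓ := (π.line_spec F.ne).1
  obtain ⟨P₁, p1, p2, p3⟩ := hC
  obtain ⟨P₂, q1, q2⟩ := exists_prod_aux A h₂
  refine ⟨P₂, q1, q2, ?_⟩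
  have notMem_P₁ := prod_aux_notMem h₁ hA p1 p2
  have notMem_P₂ := prod_aux_notMem h₂ hA q1 q2
  have ne_of : ∀ {X Y : P}, X ∈ π.line F.O F.I → Y ∉ π.line F.O F.I → X ≠ Y :=
    fun hX hY e => hY (e ▸ hX)
  have mO : F.O ∈ π.line F.O F.I := π.left_mem_line _ _
  have mI : F.I ∈ π.line F.O F.I := π.right_mem_line _ _
  obtain ⟨l₁, o₁, m₁⟩ := π.line_spec (ne_of mO h₁)
  obtain ⟨l₂, o₂, m₂⟩ := π.line_spec (ne_of mO h₂)
  have nm : π.line F.O B₁ ≠ π.line F.O B₂ := fun e => h₁₂ (e ▸ m₂)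
  have n₁ : π.line F.O F.I ≠ π.line F.O B₁ := fun e => h₁ (e ▸ m₁)
  have n₂ : π.line F.O F.I ≠ π.line F.O B₂ := fun e => h₂ (e ▸ m₂)
  have nB : B₁ ≠ B₂ := fun e => h₁₂ (e ▸ m₁)
  have nP : P₁ ≠ P₂ := fun e =>
    notMem_P₁ (π.eq_of_mem_inter l₁ l₂ nm p2 (e ▸ q2) o₁ o₂ ▸ mO)
  have nBP₁ := prod_aux_ne h₁ hA' p1
  have nBP₂ := prod_aux_ne h₂ hA' q1
  have lB₁ := π.line_spec (ne_of B.2 h₁)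
  -- otherwise `B`, `B₁`, `P₁` would be collinear, and `B` would be on the line `OB₁`
  have nBC : B.1 ≠ C.1 := by
    intro e
    rw [← e] at p3
    have e' := (π.par_spec lB₁.1 P₁).2.2.eq_of_mem p3 lB₁.2.1
    have e'' := (π.line_eq nBP₁ l₁ m₁ p2).symm.trans
      (π.line_eq nBP₁ lB₁.1 lB₁.2.2 (e' ▸ (π.par_spec lB₁.1 P₁).2.1))
    exact hB (Subtype.ext (eq_zero_of_mem h₁ B.2 (e''.symm ▸ lB₁.2.1)))
  have s₁ := π.parallel_line_of_mem_par (π.line_spec (ne_of mI h₁)).1 (ne_of A.2 notMem_P₁) p1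
  have s₂ := π.parallel_line_of_mem_par (π.line_spec (ne_of mI h₂)).1 (ne_of A.2 notMem_P₂) q1
  rw [π.line_comm F.I, π.line_comm A.1] at s₁
  have t := hπ.parallel_line l₁ hℓ l₂ n₁.symm n₂ nm (Or.inr ⟨F.O, o₁, mO, o₂⟩) m₁ p2 mI A.2 m₂ q2
    nBP₁ (fun e => hA' (Subtype.ext e.symm)) nBP₂ (ne_of mI h₁).symm (ne_of mI h₂) nB
    (ne_of A.2 notMem_P₁).symm (ne_of A.2 notMem_P₂) nP s₁ s₂
  have s₃ := π.parallel_line_of_mem_par lB₁.1 (ne_of C.2 notMem_P₁).symm p3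
  rw [π.line_comm P₁] at s₃
  have u := hπ.parallel_line hℓ l₁ l₂ n₁ nm n₂ (Or.inr ⟨F.O, mO, o₁, o₂⟩) B.2 C.2 m₁ p2 m₂ q2
    nBC nBP₁ nBP₂ (ne_of B.2 h₁) nB (ne_of B.2 h₂) (ne_of C.2 notMem_P₁) nP
    (ne_of C.2 notMem_P₂) s₃ t
  rw [π.line_comm C.1] at u
  exact π.mem_par_of_parallel_line (π.line_spec (ne_of B.2 h₂)).1 (ne_of C.2 notMem_P₂).symm u

/-- There is always a third line through `O`: the parallel to `IB₁`. -/
theorem exists_notMem_line_zero {B₁ : P} (h : B₁ ∉ π.line F.O F.I) :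
    ∃ B₂, B₂ ∉ π.line F.O F.I ∧ B₂ ∉ π.line F.O B₁ := by
  have hℓ := (π.line_spec F.ne).1
  have hO : F.O ≠ B₁ := fun e => h (e ▸ π.left_mem_line F.O F.I)
  have hI : F.I ≠ B₁ := fun e => h (e ▸ π.right_mem_line F.O F.I)
  obtain ⟨l1, l2, l3⟩ := π.line_spec hI
  obtain ⟨p1, -, p3⟩ := π.par_spec hℓ B₁
  obtain ⟨B₂, h2, h2'⟩ := π.exists_mem_par hℓ l1 p1 p3
    (π.not_parallel_line (π.right_mem_line _ _) h) F.O
  have hB₂ := π.notMem_of_mem_par hℓ h h2'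
  refine ⟨B₂, hB₂, fun hc => hB₂ ?_⟩
  exact prod_aux_unique (A := zero π F) h h2 hc (π.par_spec l1 F.O).2.1 (π.left_mem_line _ _) ▸
    π.left_mem_line F.O F.I

/-- The product does not depend on the auxiliary point. -/
theorem ProdVia.congr (hπ : π.Desargues) {B₁ B₂ : P} (h₁ : B₁ ∉ π.line F.O F.I)
    (h₂ : B₂ ∉ π.line F.O F.I) {A B C : π.Pt F} (hC : ProdVia B₁ A B C) : ProdVia B₂ A B C := by
  obtain ⟨C', hC'⟩ := exists_prodVia h₂ A B
  by_cases hA : A = zero π F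
  · subst hA
    exact ((hC.zero_left h₁).trans (hC'.zero_left h₂).symm) ▸ hC'
  by_cases hA' : A = one π F
  · subst hA'
    exact ((hC.one_left h₁).trans (hC'.one_left h₂).symm) ▸ hC'
  by_cases hB : B = zero π F
  · subst hB
    exact ((hC.zero_right h₁).trans (hC'.zero_right h₂).symm) ▸ hC'
  by_cases h₁₂ : B₂ ∈ π.line F.O B₁
  · obtain ⟨B₃, h₃, h₁₃⟩ := exists_notMem_line_zero h₁
    refine (hC.move hπ h₁ h₃ h₁₃ hA hA' hB).move hπ h₃ h₂ (fun h => h₁₃ ?_) hA hA' hB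
    have hO₁ : F.O ≠ B₁ := fun e => h₁ (e ▸ π.left_mem_line F.O F.I)
    have hO₂ : F.O ≠ B₂ := fun e => h₂ (e ▸ π.left_mem_line F.O F.I)
    have hO₃ : F.O ≠ B₃ := fun e => h₃ (e ▸ π.left_mem_line F.O F.I)
    rw [← π.line_eq hO₂ (π.line_spec hO₁).1 (π.left_mem_line _ _) h₁₂,
      π.line_eq hO₂ (π.line_spec hO₃).1 (π.left_mem_line _ _) h]
    exact π.right_mem_line _ _
  · exact hC.move hπ h₁ h₂ h₁₂ hA hA' hB

theorem IsProd.unique (hπ : π.Desargues) {A B C C' : π.Pt F} (h : IsProd A B C)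
    (h' : IsProd A B C') : C = C' := by
  obtain ⟨B₁, h₁, hC⟩ := h
  obtain ⟨B₂, h₂, hC'⟩ := h'
  exact ProdVia.unique h₂ (ProdVia.congr hπ h₁ h₂ hC) hC'

theorem IsProd.unique_right (hπ : π.Desargues) {A B B' C : π.Pt F} (hA : A ≠ zero π F)
    (h : IsProd A B C) (h' : IsProd A B' C) : B = B' := by
  obtain ⟨B₁, h₁, hC⟩ := h
  obtain ⟨B₂, h₂, hC'⟩ := h'
  exact ProdVia.unique_right h₂ hA (ProdVia.congr hπ h₁ h₂ hC) hC'

end Prod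

/-! ### The action of a dilatation -/

section Map

variable {P : Type*} {π : AffinePlane P} {δ : P ≃ P} {F : Frame P}

theorem Parallel.image {ℓ m : Set P} (h : Parallel ℓ m) : Parallel (δ '' ℓ) (δ '' m) := by
  rcases h with rfl | h
  · exact Or.inl rfl
  · right
    rw [← Set.image_inter δ.injective, h, Set.image_empty]

theorem IsCollineation.map_line (hδ : π.IsCollineation δ) {A B : P} (h : A ≠ B) :
    π.line (δ A) (δ B) = δ '' π.line A B := by
  obtain ⟨h1, h2, h3⟩ := π.line_spec h
  exact π.line_eq (δ.injective.ne h) (hδ _ h1) ⟨A, h2, rfl⟩ ⟨B, h3, rfl⟩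

theorem IsCollineation.map_mem_par (hδ : π.IsCollineation δ) {ℓ : Set P} (hℓ : ℓ ∈ π.lines)
    {X Y : P} (h : Y ∈ π.par ℓ X) : δ Y ∈ π.par (δ '' ℓ) (δ X) := by
  obtain ⟨h1, h2, h3⟩ := π.par_spec hℓ X
  rw [π.par_eq (hδ _ hℓ) (hδ _ h1) ⟨X, h2, rfl⟩ h3.image]
  exact ⟨Y, h, rfl⟩

theorem IsCollineation.map_mem_par_line (hδ : π.IsCollineation δ) {A B X Y : P} (hAB : A ≠ B)
    (h : Y ∈ π.par (π.line A B) X) : δ Y ∈ π.par (π.line (δ A) (δ B)) (δ X) := by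
  rw [hδ.map_line hAB]
  exact hδ.map_mem_par (π.line_spec hAB).1 h

theorem IsCollineation.map_notMem (hδ : π.IsCollineation δ) {X : P} (h : X ∉ π.line F.O F.I) :
    δ X ∉ π.line (F.map δ).O (F.map δ).I := by
  rw [show π.line (F.map δ).O (F.map δ).I = _ from hδ.map_line F.ne]
  rintro ⟨Y, hY, e⟩
  exact h (δ.injective e ▸ hY)

theorem IsSum.mapPt (hδ : π.IsDilatation δ) {A B C : π.Pt F} (h : IsSum A B C) :
    IsSum (hδ.mapPt A) (hδ.mapPt B) (hδ.mapPt C) := by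
  obtain ⟨B₁, hB₁, P₁, h1, h2, h3⟩ := h
  have hO : F.O ≠ B₁ := fun h => hB₁ (h ▸ π.left_mem_line F.O F.I)
  have hB : B.1 ≠ B₁ := fun h => hB₁ (h ▸ B.2)
  have hc := hδ.collineation
  exact ⟨δ B₁, hc.map_notMem hB₁, δ P₁, hc.map_mem_par_line F.ne h1, hc.map_mem_par_line hO h2,
    hc.map_mem_par_line hB h3⟩

theorem IsProd.mapPt (hδ : π.IsDilatation δ) {A B C : π.Pt F} (h : IsProd A B C) :
    IsProd (hδ.mapPt A) (hδ.mapPt B) (hδ.mapPt C) := by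
  obtain ⟨B₁, hB₁, P₁, h1, h2, h3⟩ := h
  have hO : F.O ≠ B₁ := fun h => hB₁ (h ▸ π.left_mem_line F.O F.I)
  have hI : F.I ≠ B₁ := fun h => hB₁ (h ▸ π.right_mem_line F.O F.I)
  have hB : B.1 ≠ B₁ := fun h => hB₁ (h ▸ B.2)
  have hc := hδ.collineation
  have h2' : δ P₁ ∈ π.line (δ F.O) (δ B₁) := by
    rw [hc.map_line hO]
    exact ⟨P₁, h2, rfl⟩
  exact ⟨δ B₁, hc.map_notMem hB₁, δ P₁, hc.map_mem_par_line hI h1, h2',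
    hc.map_mem_par_line hB h3⟩

theorem isSum_add (A B : π.Pt F) : IsSum A B (add A B) := (exists_isSum A B).choose_spec

theorem isProd_mul (A B : π.Pt F) : IsProd A B (mul A B) := (exists_isProd A B).choose_spec

theorem isSum_neg (A : π.Pt F) : IsSum A (neg A) (zero π F) := (exists_isSum_zero A).choose_spec

theorem isProd_inv {A : π.Pt F} (hA : A ≠ zero π F) : IsProd A (inv A) (one π F) := by
  rw [inv, dif_neg hA]
  exact (exists_isProd_one A hA).choose_spec

namespace IsDilatation

theorem mapPt_injective (hδ : π.IsDilatation δ) :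
    Function.Injective (hδ.mapPt : π.Pt F → π.Pt (F.map δ)) := fun _ _ h =>
  Subtype.ext (δ.injective (congrArg Subtype.val h))

theorem mapPt_zero (hδ : π.IsDilatation δ) : hδ.mapPt (zero π F) = zero π (F.map δ) := rfl

theorem mapPt_add (hπ : π.Desargues) (hδ : π.IsDilatation δ) (A B : π.Pt F) :
    hδ.mapPt (add A B) = add (hδ.mapPt A) (hδ.mapPt B) :=
  ((isSum_add A B).mapPt hδ).unique hπ (isSum_add _ _)

theorem mapPt_mul (hπ : π.Desargues) (hδ : π.IsDilatation δ) (A B : π.Pt F) :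
    hδ.mapPt (mul A B) = mul (hδ.mapPt A) (hδ.mapPt B) :=
  ((isProd_mul A B).mapPt hδ).unique hπ (isProd_mul _ _)

theorem mapPt_neg (hπ : π.Desargues) (hδ : π.IsDilatation δ) (A : π.Pt F) :
    hδ.mapPt (neg A) = neg (hδ.mapPt A) :=
  ((isSum_neg A).mapPt hδ).unique_right hπ (isSum_neg _)

theorem mapPt_inv (hπ : π.Desargues) (hδ : π.IsDilatation δ) (A : π.Pt F) :
    hδ.mapPt (inv A) = inv (hδ.mapPt A) := by
  by_cases hA : A = zero π F
  · -- both sides are the conventional value `O`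
    subst hA
    rw [inv, dif_pos rfl, mapPt_zero, inv, dif_pos rfl]
  · have hA' : hδ.mapPt A ≠ zero π (F.map δ) := fun h =>
      hA (hδ.mapPt_injective (h.trans hδ.mapPt_zero.symm))
    exact ((isProd_inv hA).mapPt hδ).unique_right hπ hA' (isProd_inv hA')

theorem mapPt_sub (hπ : π.Desargues) (hδ : π.IsDilatation δ) (A B : π.Pt F) :
    hδ.mapPt (sub A B) = sub (hδ.mapPt A) (hδ.mapPt B) := by
  rw [sub, mapPt_add hπ, mapPt_neg hπ, sub]

end IsDilatation

end Map

end AffinePlane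

theorem mainTheorem2 {P : Type*} (π : AffinePlane P) (hπ : π.Desargues)
    (δ : P ≃ P) (hδ : π.IsDilatation δ) (F : AffinePlane.Frame P)
    (A B C : π.Pt F) (hBC : B ≠ C) :
    hδ.mapPt (AffinePlane.ratio A B C) =
      AffinePlane.ratio (hδ.mapPt A) (hδ.mapPt B) (hδ.mapPt C) := by
  rw [AffinePlane.ratio, hδ.mapPt_mul hπ, hδ.mapPt_inv hπ, hδ.mapPt_sub hπ, hδ.mapPt_sub hπ,
    AffinePlane.ratio]
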